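/- Let $\mathcal A$ be a finite alphabet. A *substitution* is a map $\sigma:\mathcal A\to\mathcal A^+$ to non-empty words, extended by concatenation to words and to one- and two-sided sequences; its *incidence matrix* has as $(i,j)$ entry the number of occurrences of $i$ in $\sigma(j)$. Let $\boldsymbol\sigma=(\sigma_n)_{n\ge 0}$ be a sequence of substitutions on $\mathcal A$ (a *directive sequence*), put $\sigma_{[n,N)}=\sigma_n\circ\cdots\circ\sigma_{N-1}$, and let $T$ denote the left shift. * $X^{(n)}_{\boldsymbol\sigma}$ is the set of $x\in\mathcal A^{\mathbb Z}$ all of whose finite subwords are subwords of some $\sigma_{[n,N)}(a)$ with $a\in\mathcal A$, $N>n$; $X_{\boldsymbol\sigma}=X^{(0)}_{\boldsymbol\sigma}$; $\mathcal L^{(n)}_{\boldsymbol\sigma}$ is the set of finite words occurring in points of $X^{(n)}_{\boldsymbol\sigma}$; and $\tilde X^{(n)}_{\boldsymbol\sigma}\subset\mathcal A^{\mathbb N}$ is the set of one-sided sequences all of whose finite subwords lie in $\mathcal L^{(n)}_{\boldsymbol\sigma}$. * $\boldsymbol\sigma$ is *finitary* if $\{\sigma_n:n\ge 0\}$ is finite;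 *primitive* if for every $n$ there is $N>n$ such that $\sigma_{[n,N)}$ has a positive incidence matrix; *constant-length with length sequence* $(q_n)$ if $|\sigma_n(a)|=q_n$ for all $n$ and all $a\in\mathcal A$. * A word is *essential* if it lies in $\mathcal L^{(n)}_{\boldsymbol\sigma}$ for infinitely many $n$, and *fully essential* if it lies in $\mathcal L^{(n)}_{\boldsymbol\sigma}$ for every $n$. * $\boldsymbol\sigma$ is *prefix-straight* if for each letter $a$ there is exactly one right-infinite sequence of the form $\lim_k\sigma_{[0,n_k)}(a)$ with $n_k$ strictly increasing. It is *straight* if for each essential two-letter word $ab$ there is exactly one bi-infinite sequence of the form $\lim_k\sigma_{[0,n_k)}(a)\cdot\lim_k\sigma_{[0,n_k)}(b)$ with $n_k$ strictly increasing. * A centred $\sigma_n$-representation of $y$ is a pair $(k,x)$ with $y=T^k\sigma_n(x)$ and $0\le k<|\sigma_n(x_0)|$. A sequence $y$ is *aperiodic* if $T^ky\ne y$ for all $k\ge 1$. $\boldsymbol\sigma$ is *recognizable (for aperiodic points)* if for each $n$ every aperiodic $y\in\mathcal A^{\mathbb Z}$ has at most one centred $\sigma_n$-representation with $x\in X^{(n+1)}_{\boldsymbol\sigma}$.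 It is *one-sided recognizable (for aperiodic points)* if for each $n$ every aperiodic $y\in\tilde X^{(n)}_{\boldsymbol\sigma}$ has exactly one centred $\sigma_n$-representation with $x\in\tilde X^{(n+1)}_{\boldsymbol\sigma}$. * The *maximal equicontinuous factor* of $(X_{\boldsymbol\sigma},T)$ is the (unique up to conjugacy) factor $(Z,S)$ with $Z$ compact Hausdorff, $S$ a homeomorphism of $Z$ and $\{S^n:n\in\mathbb Z\}$ equicontinuous, through which every other such factor of $(X_{\boldsymbol\sigma},T)$ factors. **Corollary (cor:cobham).** Let $\boldsymbol\sigma=(\sigma_n)_{n\ge0}$ and $\tilde{\boldsymbol\sigma}=(\tilde\sigma_n)_{n\ge0}$ be two finitary, primitive, constant-length directive sequences on $\mathcal A$, with length sequences $(q_n)_{n\ge0}$ and $(\tilde q_n)_{n\ge0}$, where each $q_n\ge2$ and each $\tilde q_n\ge2$, and where, in each of the two length sequences, every value that occurs does so infinitely often. Suppose that each of the two directive sequences has a fully essential word of length $2$. Suppose that either * $\boldsymbol\sigma$ and $\tilde{\boldsymbol\sigma}$ are both prefix-straight and one-sided recognizable (for aperiodic points), or * $\boldsymbol\sigma$ and $\tilde{\boldsymbol\sigma}$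 are both straight and recognizable (for aperiodic points). If some prime divides some $q_n$ but divides no $\tilde q_m$, and if $(X_{\boldsymbol\sigma},T)$ and $(X_{\tilde{\boldsymbol\sigma}},T)$ have the same maximal equicontinuous factor (up to topological conjugacy), then $X_{\boldsymbol\sigma}$ and $X_{\tilde{\boldsymbol\sigma}}$ are both finite. -/

import Mathlib

universe u v

namespace SAdic

/-! ### Substitutions and their action on words and sequences -/

/-- A substitution on the alphabet `A`: every letter is sent to a non-empty word. -/
structure Substitution (A : Type u) where
  image : A → List A
  image_ne_nil : ∀ a, image a ≠ []

variable {A : Type u}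

/-- The morphism of words defined by a substitution (by concatenation). -/
def Substitution.onWord (s : Substitution A) (w : List A) : List A :=
  w.flatMap s.image

theorem Substitution.length_le_onWord (s : Substitution A) (w : List A) :
    w.length ≤ (s.onWord w).length := by
  induction w with
  | nil => simp
  | cons a w ih =>
    have h : 0 < (s.image a).length := List.length_pos_iff.mpr (s.image_ne_nil a)
    simp only [Substitution.onWord, List.flatMap_cons, List.length_append, List.length_cons] at ih ⊢
    omega

theorem Substitution.onWord_ne_nil (s : Substitution A) {w : List A} (hw : w ≠ []) :
    s.onWord w ≠ [] := by
  have h := s.length_le_onWord w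
  have h' : 0 < w.length := List.length_pos_iff.mpr hw
  exact List.length_pos_iff.mp (by omega)

/-- The identity substitution. -/
def Substitution.id : Substitution A where
  image a := [a]
  image_ne_nil a := by simp

/-- The composition `s ∘ t`. -/
def Substitution.comp (s t : Substitution A) : Substitution A where
  image a := s.onWord (t.image a)
  image_ne_nil a := s.onWord_ne_nil (t.image_ne_nil a)

/-- The subword `x_i x_{i+1} ⋯ x_{i+l-1}` of a two-sided sequence. -/
def subword (x : ℤ → A) (i : ℤ) (l : ℕ) : List A :=
  (List.range l).map fun j : ℕ => x (i + j)

/-- The subword `x_i x_{i+1} ⋯ x_{i+l-1}` of a one-sided sequence. -/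
def subwordOne (x : ℕ → A) (i l : ℕ) : List A :=
  (List.range l).map fun j : ℕ => x (i + j)

/-- The left shift `T` on two-sided sequences. -/
def shift (x : ℤ → A) : ℤ → A := fun i => x (i + 1)

/-- The left shift `T` on one-sided sequences. -/
def shiftOne (x : ℕ → A) : ℕ → A := fun i => x (i + 1)

/-- The image `σ(x) = ⋯ σ(x_{-2}) σ(x_{-1}) . σ(x_0) σ(x_1) ⋯` of a two-sided sequence:
the letter with index `i ≥ 0` is letter `i` of the word `σ(x_0 ⋯ x_i)`, and the letter with index
`-(i+1)` is letter `i`, counted from the right, of the word `σ(x_{-(i+1)} ⋯ x_{-1})`. -/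
def Substitution.onTwoSided (s : Substitution A) (x : ℤ → A) : ℤ → A
  | Int.ofNat i => (s.onWord (subword x 0 (i + 1)))[i]'(by
      have h := s.length_le_onWord (subword x 0 (i + 1))
      simp only [subword, List.length_map, List.length_range] at h ⊢
      omega)
  | Int.negSucc i => (s.onWord (subword x (-((i : ℤ) + 1)) (i + 1))).reverse[i]'(by
      have h := s.length_le_onWord (subword x (-((i : ℤ) + 1)) (i + 1))
      simp only [subword, List.length_map, List.length_range, List.length_reverse] at h ⊢
      omega)

/-- The image `σ(x) = σ(x_0) σ(x_1) ⋯` of a one-sided sequence. -/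
def Substitution.onOneSided (s : Substitution A) (x : ℕ → A) : ℕ → A :=
  fun i => (s.onWord (subwordOne x 0 (i + 1)))[i]'(by
      have h := s.length_le_onWord (subwordOne x 0 (i + 1))
      simp only [subwordOne, List.length_map, List.length_range] at h ⊢
      omega)

/-- The incidence matrix: the entry `(i, j)` is the number of occurrences of `i` in `σ(j)`. -/
def Substitution.incidenceMatrix [DecidableEq A] (s : Substitution A) : Matrix A A ℕ :=
  fun i j => (s.image j).count i

/-! ### Directive sequences, their languages and their shifts -/

/-- The substitution `σ_{[n, n+k)} = σ_n ∘ σ_{n+1} ∘ ⋯ ∘ σ_{n+k-1}`. -/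
def block (σ : ℕ → Substitution A) (n : ℕ) : ℕ → Substitution A
  | 0 => Substitution.id
  | k + 1 => (block σ n k).comp (σ (n + k))

/-- `σ` takes its values in a finite set of substitutions. -/
def Finitary (σ : ℕ → Substitution A) : Prop :=
  (Set.range σ).Finite

/-- For each `n` some `σ_{[n, N)}` with `N > n` has a positive incidence matrix. -/
def Primitive [DecidableEq A] (σ : ℕ → Substitution A) : Prop :=
  ∀ n, ∃ k, 0 < k ∧ ∀ i j, 0 < (block σ n k).incidenceMatrix i j

/-- `σ` is constant-length with length sequence `q`. -/
def HasLengths (σ : ℕ → Substitution A) (q : ℕ → ℕ) : Prop :=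
  ∀ n a, ((σ n).image a).length = q n

/-- The words that are subwords of some `σ_{[n, N)}(a)`, with `a` a letter and `N > n`. -/
def preLanguage (σ : ℕ → Substitution A) (n : ℕ) : Set (List A) :=
  {w | ∃ a k, 0 < k ∧ w <:+: (block σ n k).image a}

/-- The two-sided shift `X_σ^{(n)}`. -/
def shiftSpace (σ : ℕ → Substitution A) (n : ℕ) : Set (ℤ → A) :=
  {x | ∀ i l, subword x i l ∈ preLanguage σ n}

/-- The language `L_σ^{(n)}`: the words that occur in some point of `X_σ^{(n)}`. -/
def language (σ : ℕ → Substitution A) (n : ℕ) : Set (List A) :=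
  {w | ∃ x ∈ shiftSpace σ n, ∃ i, subword x i w.length = w}

/-- The one-sided shift defined by the language `L_σ^{(n)}`. -/
def shiftSpaceOne (σ : ℕ → Substitution A) (n : ℕ) : Set (ℕ → A) :=
  {x | ∀ i l, subwordOne x i l ∈ language σ n}

theorem shift_mem_shiftSpace (σ : ℕ → Substitution A) (n : ℕ) {x : ℤ → A}
    (hx : x ∈ shiftSpace σ n) : shift x ∈ shiftSpace σ n := by
  intro i l
  have h := hx (i + 1) l
  have e : subword (shift x) i l = subword x (i + 1) l := by
    simp only [subword, shift]
    refine List.map_congr_left fun j _ => ?_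
    congr 1
    ring
  rwa [e]

/-- The `S`-adic shift `(X_σ, T)`, where `X_σ = X_σ^{(0)}`: its transformation. -/
def adicShift (σ : ℕ → Substitution A) : shiftSpace σ 0 → shiftSpace σ 0 :=
  fun x => ⟨shift x.1, shift_mem_shiftSpace σ 0 x.2⟩

/-! ### Recognizability -/

/-- `(k, x)` is a centred `s`-representation of `y`: `y = T^k s(x)` with `0 ≤ k < |s(x_0)|`. -/
def IsRepresentation (s : Substitution A) (k : ℕ) (x y : ℤ → A) : Prop :=
  y = shift^[k] (s.onTwoSided x) ∧ k < (s.image (x 0)).length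

/-- `(k, x)` is a centred `s`-representation of the one-sided sequence `y`. -/
def IsRepresentationOne (s : Substitution A) (k : ℕ) (x y : ℕ → A) : Prop :=
  y = shiftOne^[k] (s.onOneSided x) ∧ k < (s.image (x 0)).length

/-- The two-sided sequence `y` is aperiodic. -/
def Aperiodic (y : ℤ → A) : Prop := ∀ k, 1 ≤ k → shift^[k] y ≠ y

/-- The one-sided sequence `y` is aperiodic. -/
def AperiodicOne (y : ℕ → A) : Prop := ∀ k, 1 ≤ k → shiftOne^[k] y ≠ y

/-- Recognizability of `σ` (for aperiodic points): for each `n`, every aperiodic two-sided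
sequence has at most one centred `σ_n`-representation `(k, x)` with `x` in `X_σ^{(n+1)}`. -/
def Recognizable (σ : ℕ → Substitution A) : Prop :=
  ∀ n, ∀ y : ℤ → A, Aperiodic y →
    {r : ℕ × (ℤ → A) | r.2 ∈ shiftSpace σ (n + 1) ∧
      IsRepresentation (σ n) r.1 r.2 y}.Subsingleton

/-- One-sided recognizability of `σ` (for aperiodic points): for each `n`, every aperiodic point
of the one-sided shift of level `n` has a unique centred `σ_n`-representation `(k, x)` with `x`
in the one-sided shift of level `n + 1`. -/
def OneSidedRecognizable (σ : ℕ → Substitution A) : Prop :=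
  ∀ n, ∀ y ∈ shiftSpaceOne σ n, AperiodicOne y →
    ∃! r : ℕ × (ℕ → A), r.2 ∈ shiftSpaceOne σ (n + 1) ∧ IsRepresentationOne (σ n) r.1 r.2 y

/-! ### Essential words and straightness -/

/-- `w` is essential: it belongs to `L_σ^{(n)}` for infinitely many `n`. -/
def Essential (σ : ℕ → Substitution A) (w : List A) : Prop :=
  {n | w ∈ language σ n}.Infinite

/-- `w` is fully essential: it belongs to `L_σ^{(n)}` for each `n`. -/
def FullyEssential (σ : ℕ → Substitution A) (w : List A) : Prop :=
  ∀ n, w ∈ language σ n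

/-- The right-infinite sequence `u` is the limit of the finite words `w_k`. -/
def ConvergesRight (w : ℕ → List A) (u : ℕ → A) : Prop :=
  ∀ i, ∀ᶠ k in Filter.atTop, (w k)[i]? = some (u i)

/-- The bi-infinite sequence `u` is the limit of the pointed words `v_k . w_k`, where the point
sits between the indices `-1` and `0`. -/
def ConvergesTwoSided (v w : ℕ → List A) (u : ℤ → A) : Prop :=
  ∀ i : ℕ, ∀ᶠ k in Filter.atTop,
    (w k)[i]? = some (u i) ∧ (v k).reverse[i]? = some (u (-((i : ℤ) + 1)))

/-- The set of right-infinite sequences `lim_k σ_{[0, n_k)}(a)`, over all sequences `(n_k)`. -/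
def limitsRight (σ : ℕ → Substitution A) (a : A) : Set (ℕ → A) :=
  {u | ∃ n : ℕ → ℕ, StrictMono n ∧
    ConvergesRight (fun k => (block σ 0 (n k)).image a) u}

/-- The set of bi-infinite sequences `lim_k σ_{[0, n_k)}(a) . lim_k σ_{[0, n_k)}(b)`, over all
sequences `(n_k)`. -/
def limitsTwoSided (σ : ℕ → Substitution A) (a b : A) : Set (ℤ → A) :=
  {u | ∃ n : ℕ → ℕ, StrictMono n ∧
    ConvergesTwoSided (fun k => (block σ 0 (n k)).image a)
      (fun k => (block σ 0 (n k)).image b) u}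

/-- `σ` is straight: each essential two-letter word has exactly one limit. -/
def Straight (σ : ℕ → Substitution A) : Prop :=
  ∀ a b, Essential σ [a, b] → ∃ u, limitsTwoSided σ a b = {u}

/-- `σ` is prefix-straight: each letter has exactly one right-infinite limit. -/
def PrefixStraight (σ : ℕ → Substitution A) : Prop :=
  ∀ a, ∃ u, limitsRight σ a = {u}

/-! ### Maximal equicontinuous factors -/

/-- `(Z, S)` is an equicontinuous factor of `(X, T)` with factor map `π`: the space `Z` is compact
Hausdorff (with its unique uniformity), the family `{S^n : n ∈ ℤ}` is equicontinuous and `π` is a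
continuous equivariant surjection. -/
structure IsEquicontinuousFactor {X : Type u} {Z : Type v} [TopologicalSpace X] [UniformSpace Z]
    (T : X → X) (S : Z ≃ₜ Z) (π : X → Z) : Prop where
  compactSpace : CompactSpace Z
  t2Space : T2Space Z
  equicontinuous : Equicontinuous fun (n : ℤ) (z : Z) => (S ^ n) z
  continuous : Continuous π
  surjective : Function.Surjective π
  semiconj : Function.Semiconj π T S

/-- `(Z, S)` is the maximal equicontinuous factor of `(X, T)` with factor map `π`: every
equicontinuous factor of `(X, T)` factors through it. (Every factor of `X` is a quotient of `X`,
so the universe of `X` is large enough.) -/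
structure IsMaximalEquicontinuousFactor {X : Type u} {Z : Type v} [TopologicalSpace X]
    [UniformSpace Z] (T : X → X) (S : Z ≃ₜ Z) (π : X → Z) : Prop where
  isFactor : IsEquicontinuousFactor T S π
  maximal : ∀ (Z' : Type u) [UniformSpace Z'] (S' : Z' ≃ₜ Z') (π' : X → Z'),
    IsEquicontinuousFactor T S' π' →
      ∃ φ : Z → Z', Continuous φ ∧ Function.Semiconj φ S S' ∧ φ ∘ π = π'

/-- `(X, T)` and `(Y, R)` have the same maximal equicontinuous factor (up to conjugacy): a single
system `(Z, S)` is the maximal equicontinuous factor of both. -/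
def SameMaximalEquicontinuousFactor {X Y : Type u} [TopologicalSpace X] [TopologicalSpace Y]
    (T : X → X) (R : Y → Y) : Prop :=
  ∃ (Z : Type u) (_ : UniformSpace Z) (S : Z ≃ₜ Z) (π : X → Z) (ρ : Y → Z),
    IsMaximalEquicontinuousFactor T S π ∧ IsMaximalEquicontinuousFactor R S ρ

end SAdic

namespace SAdic

/-! Finite rotations that are factors of the two shifts are compared; every such rotation factors
through the maximal equicontinuous factor, so two shifts with the same one have the same cyclic
factors (`HasCyclicFactor.of_sameMaximalEquicontinuousFactor`).

If `X_σ` is infinite, minimality excludes periodic points, so recognizability applies at each level.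
It makes the residue of `k` modulo `q_0 ⋯ q_{n-1}` well defined in `y = T^k σ_{[0,n)}(z)`, and this
residue is a factor map onto the rotation of that order (`RecognizableOn.hasCyclicFactor`). A prime
`p` dividing one length divides infinitely many, so every `ℤ/p^k` is a cyclic factor.

Conversely, a cyclic factor of order `m` coprime to all lengths has `m ≤ |A|²`
(`HasCyclicFactor.le_card_sq`): it is read off a bounded window, hence, at the seams of a long block
decomposition, off two adjacent letters, while passing to the next seam adds a unit of `ℤ/m`.

If `p` divides some `q_n` and no `r_n`, an infinite `X_σ` would thus give `X_τ` the factor `ℤ/p^k`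
for every `k`, which is impossible. With `X_σ` finite, an infinite `X_τ` would force arbitrarily
large cyclic factors on a finite set. -/

section Combinatorics

variable {A : Type u}

/-! ### Words and substitutions of constant length -/

/-- The substitution `s` has constant length `Q`. -/
def Substitution.ConstLength (s : Substitution A) (Q : ℕ) : Prop :=
  ∀ a, (s.image a).length = Q

theorem Substitution.image_ext {s t : Substitution A} (h : ∀ a, s.image a = t.image a) : s = t := by
  cases s; cases t; congr; exact funext h

theorem Substitution.onWord_append (s : Substitution A) (v w : List A) :
    s.onWord (v ++ w) = s.onWord v ++ s.onWord w := by
  simp [Substitution.onWord]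

theorem Substitution.onWord_cons (s : Substitution A) (a : A) (w : List A) :
    s.onWord (a :: w) = s.image a ++ s.onWord w := by
  simp [Substitution.onWord]

theorem Substitution.onWord_infix (s : Substitution A) {v w : List A} (h : v <:+: w) :
    s.onWord v <:+: s.onWord w := by
  obtain ⟨x, y, rfl⟩ := h
  exact ⟨s.onWord x, s.onWord y, by simp [onWord_append]⟩

theorem Substitution.image_infix_onWord (s : Substitution A) {a : A} {w : List A} (h : a ∈ w) :
    s.image a <:+: s.onWord w := by
  obtain ⟨x, y, rfl⟩ := List.append_of_mem h
  exact ⟨s.onWord x, s.onWord y, by simp [onWord_append, onWord_cons]⟩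

theorem Substitution.comp_onWord (s t : Substitution A) (w : List A) :
    (s.comp t).onWord w = s.onWord (t.onWord w) := by
  simp only [Substitution.onWord, Substitution.comp, List.flatMap_assoc]

theorem Substitution.comp_assoc (s t r : Substitution A) :
    (s.comp t).comp r = s.comp (t.comp r) :=
  Substitution.image_ext fun a => Substitution.comp_onWord s t (r.image a)

theorem Substitution.comp_id (s : Substitution A) : s.comp Substitution.id = s :=
  Substitution.image_ext fun a => by simp [Substitution.comp, Substitution.id, Substitution.onWord]

theorem Substitution.id_comp (s : Substitution A) : Substitution.id.comp s = s :=
  Substitution.image_ext fun a => by simp [Substitution.comp, Substitution.id, Substitution.onWord]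

theorem Substitution.ConstLength.length_onWord {s : Substitution A} {Q : ℕ}
    (h : s.ConstLength Q) (w : List A) : (s.onWord w).length = Q * w.length := by
  induction w with
  | nil => simp [Substitution.onWord]
  | cons a w ih => rw [Substitution.onWord_cons, List.length_append, h a, ih, List.length_cons]; ring

theorem Substitution.ConstLength.comp {s t : Substitution A} {Q R : ℕ}
    (hs : s.ConstLength Q) (ht : t.ConstLength R) : (s.comp t).ConstLength (Q * R) := fun a => by
  rw [Substitution.comp, hs.length_onWord, ht a]

theorem Substitution.ConstLength.pos {s : Substitution A} {Q : ℕ}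
    (h : s.ConstLength Q) (a : A) : 0 < Q :=
  h a ▸ List.length_pos_iff.mpr (s.image_ne_nil a)

/-- Constant length turns positions into division with remainder by `Q`: the quotient selects the
letter, the remainder the place in its image. -/
theorem Substitution.ConstLength.getElem?_onWord {s : Substitution A} {Q : ℕ}
    (h : s.ConstLength Q) (w : List A) (t r : ℕ) (hr : r < Q) :
    (s.onWord w)[Q * t + r]? = w[t]?.bind fun a => (s.image a)[r]? := by
  induction w generalizing t with
  | nil => simp [Substitution.onWord]
  | cons a w ih =>
    rw [Substitution.onWord_cons]
    cases t with
    | zero => simp [List.getElem?_append, h a, hr]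
    | succ t =>
      rw [List.getElem?_append_right (by rw [h a]; nlinarith), h a, List.getElem?_cons_succ, ← ih]
      congr 1
      rw [Nat.mul_succ]; omega

/-! ### Subwords of two-sided sequences -/

/-- The power `T^k` of the shift, for an integer `k`. -/
def shiftBy (k : ℤ) (x : ℤ → A) : ℤ → A := fun i => x (i + k)

theorem shiftBy_shiftBy (k l : ℤ) (x : ℤ → A) : shiftBy k (shiftBy l x) = shiftBy (k + l) x := by
  funext i; simp only [shiftBy]; congr 1; ring

theorem shiftBy_zero (x : ℤ → A) : shiftBy 0 x = x := by funext i; simp [shiftBy]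

theorem shift_iterate (k : ℕ) (x : ℤ → A) : shift^[k] x = shiftBy k x := by
  induction k with
  | zero => simp [shiftBy_zero]
  | succ k ih =>
    rw [Function.iterate_succ_apply', ih]; funext i; simp only [shift, shiftBy]; congr 1
    push_cast; ring

theorem shiftOne_iterate (k : ℕ) (x : ℕ → A) (i : ℕ) : shiftOne^[k] x i = x (i + k) := by
  induction k generalizing i with
  | zero => simp
  | succ k ih =>
    rw [Function.iterate_succ_apply']; simp only [shiftOne]; rw [ih]; congr 1; ring

theorem length_subword (x : ℤ → A) (i : ℤ) (l : ℕ) : (subword x i l).length = l := by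
  simp [subword]

theorem getElem?_subword (x : ℤ → A) (i : ℤ) {l j : ℕ} (h : j < l) :
    (subword x i l)[j]? = some (x (i + j)) := by
  simp [subword, h]

theorem subword_shiftBy (k : ℤ) (x : ℤ → A) (i : ℤ) (l : ℕ) :
    subword (shiftBy k x) i l = subword x (i + k) l := by
  simp only [subword, shiftBy]
  refine List.map_congr_left fun j _ => ?_
  congr 1; ring

theorem subword_add (x : ℤ → A) (i : ℤ) (l m : ℕ) :
    subword x i (l + m) = subword x i l ++ subword x (i + l) m := by
  simp only [subword, List.range_add, List.map_append, List.map_map]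
  congr 1
  refine List.map_congr_left fun j _ => ?_
  simp [add_assoc]

theorem subword_infix (x : ℤ → A) {i i' : ℤ} {l l' : ℕ} (h : i' ≤ i) (h' : i + l ≤ i' + l') :
    subword x i l <:+: subword x i' l' := by
  obtain ⟨a, rfl⟩ : ∃ a : ℕ, i = i' + a := ⟨(i - i').toNat, by omega⟩
  obtain ⟨b, rfl⟩ : ∃ b : ℕ, l' = a + l + b := ⟨l' - a - l, by omega⟩
  rw [subword_add, subword_add]
  exact ⟨_, _, rfl⟩

theorem exists_subword_eq_of_infix {x : ℤ → A} {w : List A} {i : ℤ} {l : ℕ}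
    (h : w <:+: subword x i l) : ∃ j, subword x j w.length = w := by
  obtain ⟨a, b, hab⟩ := h
  have hl : l = a.length + w.length + b.length := by
    rw [← length_subword x i l, ← hab]; simp [add_assoc]
  subst hl
  rw [subword_add, subword_add] at hab
  obtain ⟨h1, -⟩ := List.append_inj hab (by simp [length_subword])
  obtain ⟨-, h2⟩ := List.append_inj h1 (by simp [length_subword])
  exact ⟨_, h2.symm⟩

theorem eq_of_subword_eq {x y : ℤ → A} {i j : ℤ} {l : ℕ} (h : subword x i l = subword y j l)
    {t : ℕ} (ht : t < l) : x (i + t) = y (j + t) := by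
  have := congrArg (fun w => w[t]?) h
  simpa [getElem?_subword _ _ ht] using this

/-- One formula for both sides of the origin. With the converse `eq_onTwoSided` it replaces the
definition of `onTwoSided` by cases in all that follows. -/
theorem Substitution.ConstLength.getElem?_image {s : Substitution A} {Q : ℕ}
    (h : s.ConstLength Q) (x : ℤ → A) (t : ℤ) (r : ℕ) (hr : r < Q) :
    (s.image (x t))[r]? = some (s.onTwoSided x (Q * t + r)) := by
  rcases le_or_gt 0 t with ht | ht
  · obtain ⟨t, rfl⟩ := Int.eq_ofNat_of_zero_le ht
    have e : (Q : ℤ) * (t : ℕ) + r = Int.ofNat (Q * t + r) := by simp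
    rw [e, Substitution.onTwoSided, ← List.getElem?_eq_getElem, h.getElem?_onWord _ _ _ hr,
      getElem?_subword _ _ (by nlinarith)]
    simp
  · obtain ⟨i, hi⟩ : ∃ i : ℕ, (Q : ℤ) * t + r = Int.negSucc i := by
      refine Int.eq_negSucc_of_lt_zero ?_
      have : (r : ℤ) < Q := by exact_mod_cast hr
      nlinarith
    have hi' : (Q : ℤ) * t + r = -(i + 1) := by rw [hi, Int.negSucc_eq]
    have hle : -((i : ℤ) + 1) ≤ t := by
      have : (r : ℤ) < Q := by exact_mod_cast hr
      nlinarith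
    obtain ⟨m, hm⟩ : ∃ m : ℕ, t = -((i : ℤ) + 1) + m := ⟨(t + (i + 1)).toNat, by omega⟩
    rw [hi, Substitution.onTwoSided, ← List.getElem?_eq_getElem]
    have hlen := h.length_onWord (subword x (-((i : ℤ) + 1)) (i + 1))
    rw [length_subword] at hlen
    have hidx : Q * m + r + (i + 1) = Q * (i + 1) := by
      have : (Q : ℤ) * m + r + (i + 1) = Q * (i + 1) := by
        rw [hm] at hi'; linarith
      exact_mod_cast this
    rw [List.getElem?_reverse (by rw [hlen]; omega), hlen,
      show Q * (i + 1) - 1 - i = Q * m + r by omega, h.getElem?_onWord _ _ _ hr,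
      getElem?_subword _ _ (by omega), ← hm]
    simp

theorem Substitution.ConstLength.eq_onTwoSided {s : Substitution A} {Q : ℕ}
    (h : s.ConstLength Q) {x u : ℤ → A}
    (hu : ∀ (t : ℤ) (r : ℕ), r < Q → (s.image (x t))[r]? = some (u (Q * t + r))) :
    s.onTwoSided x = u := by
  have hQ := h.pos (x 0)
  funext i
  have h1 : (0 : ℤ) ≤ i % Q := Int.emod_nonneg _ (by omega)
  have h2 : i % (Q : ℤ) < Q := Int.emod_lt_of_pos _ (by omega)
  have e : (Q : ℤ) * (i / Q) + ((i % Q).toNat : ℤ) = i := by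
    rw [Int.toNat_of_nonneg h1]; exact Int.mul_ediv_add_emod i Q
  have := (hu (i / Q) (i % Q).toNat (by omega)).symm.trans
    (h.getElem?_image x (i / Q) (i % Q).toNat (by omega))
  rw [e] at this
  exact (Option.some.inj this).symm

theorem Substitution.ConstLength.onTwoSided_shiftBy {s : Substitution A} {Q : ℕ}
    (h : s.ConstLength Q) (k : ℤ) (x : ℤ → A) :
    s.onTwoSided (shiftBy k x) = shiftBy (Q * k) (s.onTwoSided x) := by
  refine h.eq_onTwoSided fun t r hr => ?_
  have := h.getElem?_image x (t + k) r hr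
  simp only [shiftBy]
  rw [this]; congr 2; ring

theorem Substitution.ConstLength.onTwoSided_comp {s t : Substitution A} {Q R : ℕ}
    (hs : s.ConstLength Q) (ht : t.ConstLength R) (x : ℤ → A) :
    (s.comp t).onTwoSided x = s.onTwoSided (t.onTwoSided x) := by
  refine (hs.comp ht).eq_onTwoSided fun i r hr => ?_
  have hQ := hs.pos (x 0)
  have h1 : r / Q < R := Nat.div_lt_of_lt_mul hr
  have h2 : r % Q < Q := Nat.mod_lt _ hQ
  have e := Nat.div_add_mod r Q
  conv_lhs => rw [← e]
  rw [Substitution.comp, hs.getElem?_onWord _ _ _ h2, ht.getElem?_image x i _ h1,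
    Option.bind_some, hs.getElem?_image _ _ _ h2]
  congr 2
  have e' : (Q : ℤ) * ((r / Q : ℕ) : ℤ) + ((r % Q : ℕ) : ℤ) = r := by exact_mod_cast e
  push_cast at e' ⊢
  linear_combination e'

/-- A letter of `s(x)` depends on a single letter of `x`. -/
theorem Substitution.ConstLength.onTwoSided_congr {s : Substitution A} {Q : ℕ}
    (h : s.ConstLength Q) {x y : ℤ → A} {i : ℤ} (hxy : x (i / Q) = y (i / Q)) :
    s.onTwoSided x i = s.onTwoSided y i := by
  have hQ := h.pos (x 0)
  have h1 : (0 : ℤ) ≤ i % Q := Int.emod_nonneg _ (by omega)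
  have h2 : i % (Q : ℤ) < Q := Int.emod_lt_of_pos _ (by omega)
  have e : (Q : ℤ) * (i / Q) + ((i % Q).toNat : ℤ) = i := by
    rw [Int.toNat_of_nonneg h1]; exact Int.mul_ediv_add_emod i Q
  have hx := h.getElem?_image x (i / Q) (i % Q).toNat (by omega)
  have hy := h.getElem?_image y (i / Q) (i % Q).toNat (by omega)
  rw [hxy, hy, e] at hx
  exact (Option.some.inj hx).symm

theorem Substitution.ConstLength.onWord_subword {s : Substitution A} {Q : ℕ}
    (h : s.ConstLength Q) (x : ℤ → A) (i : ℤ) (l : ℕ) :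
    s.onWord (subword x i l) = subword (s.onTwoSided x) (Q * i) (Q * l) := by
  have hQ := h.pos (x 0)
  refine List.ext_getElem? fun j => ?_
  rcases lt_or_ge j (Q * l) with hj | hj
  · have h1 : j / Q < l := Nat.div_lt_of_lt_mul hj
    have h2 : j % Q < Q := Nat.mod_lt _ hQ
    have e := Nat.div_add_mod j Q
    have e' : (Q : ℤ) * ((j / Q : ℕ) : ℤ) + ((j % Q : ℕ) : ℤ) = j := by exact_mod_cast e
    conv_lhs => rw [← e]
    rw [h.getElem?_onWord _ _ _ h2, getElem?_subword _ _ h1, getElem?_subword _ _ hj,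
      Option.bind_some, h.getElem?_image _ _ _ h2]
    congr 2
    linear_combination e'
  · rw [List.getElem?_eq_none, List.getElem?_eq_none]
    · rwa [length_subword]
    · rwa [h.length_onWord, length_subword]

/-- A word of length `2Q` in `s(w)` contains the image of a letter, if `s` has length `Q`. -/
theorem Substitution.ConstLength.exists_image_infix {s : Substitution A} {Q : ℕ}
    (h : s.ConstLength Q) (hQ : 0 < Q) {v w : List A} (hv : v.length = 2 * Q)
    (hvw : v <:+: s.onWord w) : ∃ b, s.image b <:+: v := by
  induction w with
  | nil =>
    have := hvw.length_le
    rw [h.length_onWord, hv, List.length_nil] at this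
    omega
  | cons a w ih =>
    obtain ⟨x, y, hxy⟩ := hvw
    rw [Substitution.onWord_cons] at hxy
    rcases le_or_gt Q x.length with hx | hx
    · refine ih ⟨x.drop Q, y, ?_⟩
      have := congrArg (List.drop Q) hxy
      rw [List.append_assoc, List.drop_append_of_le_length hx, List.drop_left' (h a)] at this
      rw [List.append_assoc]; exact this
    · have hlen := congrArg List.length hxy
      simp only [List.length_append, h a, hv, h.length_onWord] at hlen
      cases w with
      | nil => simp at hlen; omega
      | cons b w =>
        rw [Substitution.onWord_cons] at hxy
        -- Here `v` begins inside `s(a)`. At offset `0` it contains `s(a)`; at an offset strictly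
        -- between `0` and `Q`, its length `2Q` makes it cover the next image `s(b)`.
        rcases Nat.eq_zero_or_pos x.length with hx0 | hx0
        · rw [List.length_eq_zero_iff] at hx0
          subst hx0
          have h1 : s.image a <+: v := by
            refine List.prefix_of_prefix_length_le (l₃ := s.image a ++ (s.image b ++ s.onWord w))
              ⟨_, rfl⟩ ⟨y, by simpa using hxy⟩ (by rw [h a, hv]; omega)
          exact ⟨a, h1.isInfix⟩
        · have h1 : s.image a ++ s.image b <+: x ++ v := by
            refine List.prefix_of_prefix_length_le (l₃ := s.image a ++ (s.image b ++ s.onWord w))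
              ⟨s.onWord w, by simp⟩ ⟨y, hxy⟩ ?_
            simp only [List.length_append, h a, h b, hv]; omega
          obtain ⟨z, hz⟩ := h1
          have h2 := congrArg (List.drop x.length) hz
          rw [List.drop_left' rfl, List.append_assoc,
            List.drop_append_of_le_length (by rw [h a]; omega)] at h2
          exact ⟨b, _, z, by rw [List.append_assoc]; exact h2⟩

/-! ### Blocks of a directive sequence of constant length -/

/-- The length of `σ_{[n, n+k)}`. -/
def blockLength (q : ℕ → ℕ) (n k : ℕ) : ℕ := ∏ i ∈ Finset.range k, q (n + i)

theorem blockLength_pos {q : ℕ → ℕ} (hq : ∀ n, 2 ≤ q n) (n k : ℕ) : 0 < blockLength q n k :=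
  Finset.prod_pos fun i _ => by have := hq (n + i); omega

theorem blockLength_succ (q : ℕ → ℕ) (n k : ℕ) :
    blockLength q n (k + 1) = blockLength q n k * q (n + k) := Finset.prod_range_succ _ _

theorem blockLength_succ' (q : ℕ → ℕ) (n k : ℕ) :
    blockLength q n (k + 1) = q n * blockLength q (n + 1) k := by
  rw [blockLength, Finset.prod_range_succ', mul_comm]
  simp only [blockLength, add_zero]
  congr 1
  exact Finset.prod_congr rfl fun i _ => by congr 1; ring

theorem two_pow_le_blockLength {q : ℕ → ℕ} (hq : ∀ n, 2 ≤ q n) (n k : ℕ) :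
    2 ^ k ≤ blockLength q n k := by
  induction k with
  | zero => simp [blockLength]
  | succ k ih => rw [blockLength_succ, pow_succ]; exact Nat.mul_le_mul ih (hq _)

theorem blockLength_mono {q : ℕ → ℕ} (hq : ∀ n, 2 ≤ q n) (n : ℕ) :
    Monotone (blockLength q n) := monotone_nat_of_le_succ fun k => by
  rw [blockLength_succ]; have := hq (n + k); nlinarith

theorem HasLengths.block {σ : ℕ → Substitution A} {q : ℕ → ℕ} (h : HasLengths σ q) (n k : ℕ) :
    (block σ n k).ConstLength (blockLength q n k) := by
  induction k with
  | zero => intro a; simp [SAdic.block, Substitution.id, blockLength]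
  | succ k ih => rw [blockLength_succ]; exact ih.comp (h (n + k))

theorem block_add (σ : ℕ → Substitution A) (n k m : ℕ) :
    block σ n (k + m) = (block σ n k).comp (block σ (n + k) m) := by
  induction m with
  | zero => exact (Substitution.comp_id _).symm
  | succ m ih => rw [← add_assoc, block, ih, Substitution.comp_assoc, block, add_assoc]

theorem block_one (σ : ℕ → Substitution A) (n : ℕ) : block σ n 1 = σ n :=
  Substitution.id_comp _

theorem shiftBy_mem_shiftSpace {σ : ℕ → Substitution A} {n : ℕ} {x : ℤ → A} (k : ℤ)
    (hx : x ∈ shiftSpace σ n) : shiftBy k x ∈ shiftSpace σ n := fun i l => by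
  rw [subword_shiftBy]; exact hx _ _

theorem subword_mem_language {σ : ℕ → Substitution A} {n : ℕ} {x : ℤ → A}
    (hx : x ∈ shiftSpace σ n) (i : ℤ) (l : ℕ) : subword x i l ∈ language σ n :=
  ⟨x, hx, i, by rw [length_subword]⟩

/-- `σ_{[m, m+n)}` maps the shift of level `m + n` into the shift of level `m`. -/
theorem HasLengths.onTwoSided_mem {σ : ℕ → Substitution A} {q : ℕ → ℕ} (h : HasLengths σ q)
    {m n : ℕ} {x : ℤ → A} (hx : x ∈ shiftSpace σ (m + n)) :
    (SAdic.block σ m n).onTwoSided x ∈ shiftSpace σ m := by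
  intro i l
  have hc := h.block m n
  set Q := blockLength q m n
  have hQ : 0 < Q := hc.pos (x 0)
  -- The `l + 1` letters from index `i / Q` on have images covering `[i, i + l)`; the extra letter
  -- absorbs the offset `i % Q < Q`.
  obtain ⟨a, k, hk, hw⟩ := hx (i / Q) (l + 1)
  refine ⟨a, n + k, by omega, ?_⟩
  rw [block_add]
  refine List.IsInfix.trans ?_ ((SAdic.block σ m n).onWord_infix hw)
  rw [hc.onWord_subword]
  have h1 := Int.mul_ediv_add_emod i Q
  have h2 : (0 : ℤ) ≤ i % Q := Int.emod_nonneg _ (by omega)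
  have h3 : i % (Q : ℤ) < Q := Int.emod_lt_of_pos _ (by omega)
  refine subword_infix _ (by linarith) ?_
  have : (l : ℤ) ≤ Q * l := by
    have : (1 : ℤ) ≤ Q := by omega
    nlinarith
  push_cast
  linarith

/-- Each point of level `n` contains a complete word `σ_{[n, n+m)}(b)`. -/
theorem HasLengths.exists_image_infix {σ : ℕ → Substitution A} {q : ℕ → ℕ} (h : HasLengths σ q)
    (hq : ∀ n, 2 ≤ q n) {n : ℕ} {y : ℤ → A} (hy : y ∈ shiftSpace σ n) (m : ℕ) :
    ∃ b, (SAdic.block σ n m).image b <:+: subword y 0 (2 * blockLength q n m) := by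
  have hQ := blockLength_pos hq n m
  obtain ⟨c, K, hK, hw⟩ := hy 0 (2 * blockLength q n m)
  have hlen := hw.length_le
  rw [length_subword, h.block n K c] at hlen
  -- A block with fewer than `m` factors is too short to hold a word of length `2 * blockLength q n
  -- m`.
  have hmK : m ≤ K := by
    by_contra hlt
    have := blockLength_mono hq n (le_of_not_ge hlt)
    omega
  obtain ⟨d, rfl⟩ := Nat.exists_eq_add_of_le hmK
  rw [block_add] at hw
  exact (h.block n m).exists_image_infix hQ (length_subword _ _ _) hw

/-- Each word of the language of level `n` occurs in each point of level `n`. -/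
theorem Primitive.exists_subword_eq [DecidableEq A] {σ : ℕ → Substitution A} {q : ℕ → ℕ}
    (hp : Primitive σ) (h : HasLengths σ q) (hq : ∀ n, 2 ≤ q n) {n : ℕ} {y : ℤ → A}
    (hy : y ∈ shiftSpace σ n) {w : List A} (hw : w ∈ preLanguage σ n) :
    ∃ i, subword y i w.length = w := by
  obtain ⟨a, k, -, hwk⟩ := hw
  -- By positivity `a` occurs in `σ_{[n+k, n+k+m)}(b)` for every `b`, so any complete block of `k +
  -- m` factors in `y` contains `σ_{[n,n+k)}(a)`, hence `w`.
  obtain ⟨m, -, hm⟩ := hp (n + k)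
  obtain ⟨b, hb⟩ := h.exists_image_infix hq hy (k + m)
  have ha : a ∈ (block σ (n + k) m).image b := List.count_pos_iff.mp (hm a b)
  rw [block_add] at hb
  exact exists_subword_eq_of_infix
    (hwk.trans (((block σ n k).image_infix_onWord ha).trans hb))

end Combinatorics

section Topology

variable {A : Type u} [Fintype A] [DecidableEq A] [TopologicalSpace A] [DiscreteTopology A]

/-! ### Topology of the shift spaces and minimality -/

omit [Fintype A] [DecidableEq A] [DiscreteTopology A] in
theorem continuous_shiftBy (k : ℤ) : Continuous (shiftBy (A := A) k) :=
  continuous_pi fun i => continuous_apply (i + k)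

omit [Fintype A] [DecidableEq A] in
theorem Substitution.ConstLength.continuous_onTwoSided {s : Substitution A} {Q : ℕ}
    (h : s.ConstLength Q) : Continuous s.onTwoSided := by
  refine continuous_pi fun i => ?_
  have e : (fun x : ℤ → A => s.onTwoSided x i) =
      (fun a => s.onTwoSided (fun _ => a) i) ∘ fun x : ℤ → A => x (i / Q) :=
    funext fun x => h.onTwoSided_congr rfl
  rw [e]
  exact continuous_of_discreteTopology.comp (continuous_apply _)

omit [Fintype A] [DecidableEq A] [DiscreteTopology A] in
/-- A neighbourhood of `x` contains all sequences that agree with `x` on some window. -/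
theorem exists_window {U : Set (ℤ → A)} (hU : IsOpen U) {x : ℤ → A} (hx : x ∈ U) :
    ∃ L : ℕ, ∀ y : ℤ → A, (∀ i : ℤ, -L ≤ i → i < L → y i = x i) → y ∈ U := by
  obtain ⟨I, u, hu, hI⟩ := isOpen_pi_iff.mp hU x hx
  refine ⟨I.sup Int.natAbs + 1, fun y hy => hI fun i hi => ?_⟩
  have : i.natAbs ≤ I.sup Int.natAbs := Finset.le_sup (f := Int.natAbs) hi
  rw [hy i (by omega) (by omega)]
  exact (hu i hi).2

omit [Fintype A] [DecidableEq A] in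
theorem isClosed_shiftSpace (σ : ℕ → Substitution A) (n : ℕ) : IsClosed (shiftSpace σ n) := by
  have e : shiftSpace σ n = ⋂ (i : ℤ) (l : ℕ),
      (fun x : ℤ → A => fun j : Fin l => x (i + j)) ⁻¹'
        {v | List.ofFn v ∈ preLanguage σ n} := by
    ext x
    have : ∀ (i : ℤ) (l : ℕ), List.ofFn (fun j : Fin l => x (i + j)) = subword x i l := by
      intro i l
      refine List.ext_getElem (by simp [subword]) fun j h1 h2 => by simp [subword]
    simp [shiftSpace, this]
  rw [e]
  refine isClosed_iInter fun i => isClosed_iInter fun l => ?_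
  exact (isClosed_discrete _).preimage (continuous_pi fun j => continuous_apply _)

omit [DecidableEq A] in
theorem isCompact_shiftSpace (σ : ℕ → Substitution A) (n : ℕ) : IsCompact (shiftSpace σ n) :=
  (isClosed_shiftSpace σ n).isCompact

omit [Fintype A] [DiscreteTopology A] in
/-- The shift of level `n` is minimal. -/
theorem Primitive.shiftSpace_subset {σ : ℕ → Substitution A} {q : ℕ → ℕ} (hp : Primitive σ)
    (h : HasLengths σ q) (hq : ∀ n, 2 ≤ q n) {n : ℕ} {C : Set (ℤ → A)} (hC : IsClosed C)
    (hCX : C ⊆ shiftSpace σ n) (hne : C.Nonempty) (hinv : ∀ k, ∀ x ∈ C, shiftBy k x ∈ C) :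
    shiftSpace σ n ⊆ C := by
  intro x hx
  by_contra hxC
  obtain ⟨L, hL⟩ := exists_window hC.isOpen_compl (x := x) hxC
  obtain ⟨z, hz⟩ := hne
  obtain ⟨j, hj⟩ := hp.exists_subword_eq h hq (hCX hz) (hx (-L) (2 * L))
  rw [length_subword] at hj
  refine hL (shiftBy (j + L) z) (fun i hi hi' => ?_) (hinv _ _ hz)
  have := eq_of_subword_eq hj (t := (i + L).toNat) (by omega)
  rw [Int.toNat_of_nonneg (by omega)] at this
  simp only [shiftBy]
  convert this using 2 <;> ring

omit [Fintype A] [DecidableEq A] [TopologicalSpace A] [DiscreteTopology A] in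
-- Carrying: whole multiples of `Q` move inside the substitution, which leaves a centred
-- representation.
theorem Substitution.ConstLength.shiftBy_onTwoSided {s : Substitution A} {Q : ℕ}
    (h : s.ConstLength Q) (k : ℤ) (x : ℤ → A) :
    shiftBy k (s.onTwoSided x) = shiftBy ((k % Q).toNat : ℤ) (s.onTwoSided (shiftBy (k / Q) x)) := by
  have hQ := h.pos (x 0)
  rw [h.onTwoSided_shiftBy, shiftBy_shiftBy, Int.toNat_of_nonneg (Int.emod_nonneg _ (by omega)),
    Int.emod_add_mul_ediv]

/-- Each point of level `m` is `T^k σ_{[m, m+n)}(z)` with `z` of level `m + n`. -/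
theorem Primitive.exists_desubstitution {σ : ℕ → Substitution A} {q : ℕ → ℕ} (hp : Primitive σ)
    (h : HasLengths σ q) (hq : ∀ n, 2 ≤ q n) (hne : ∀ n, (shiftSpace σ n).Nonempty) (m n : ℕ)
    {x : ℤ → A} (hx : x ∈ shiftSpace σ m) :
    ∃ k < blockLength q m n, ∃ z ∈ shiftSpace σ (m + n),
      x = shiftBy k ((block σ m n).onTwoSided z) := by
  have hc := h.block m n
  have hQ := blockLength_pos hq m n
  set Q := blockLength q m n
  -- The set of points that can be desubstituted is a finite union of compact images, and the shift
  -- preserves it by carrying; minimality makes it everything.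
  let C : Set (ℤ → A) := ⋃ k ∈ Finset.range Q,
    (fun z => shiftBy ((k : ℕ) : ℤ) ((block σ m n).onTwoSided z)) '' shiftSpace σ (m + n)
  have hmem : ∀ y, y ∈ C ↔ ∃ k < Q, ∃ z ∈ shiftSpace σ (m + n),
      y = shiftBy k ((block σ m n).onTwoSided z) := by
    intro y
    simp only [C, Set.mem_iUnion, Finset.mem_range, Set.mem_image, exists_prop, eq_comm (a := y)]
  refine (hmem x).mp (hp.shiftSpace_subset h hq (C := C) ?_ ?_ ?_ ?_ hx)
  · refine Set.Finite.isClosed_biUnion (Finset.finite_toSet _) fun k _ => ?_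
    exact ((isCompact_shiftSpace σ (m + n)).image
      ((continuous_shiftBy _).comp hc.continuous_onTwoSided)).isClosed
  · intro y hy
    obtain ⟨k, -, z, hz, rfl⟩ := (hmem y).mp hy
    exact shiftBy_mem_shiftSpace _ (h.onTwoSided_mem hz)
  · obtain ⟨z, hz⟩ := hne (m + n)
    exact ⟨_, (hmem _).mpr ⟨0, hQ, z, hz, rfl⟩⟩
  · intro k y hy
    obtain ⟨l, -, z, hz, rfl⟩ := (hmem y).mp hy
    rw [shiftBy_shiftBy, hc.shiftBy_onTwoSided]
    have h1 : (0 : ℤ) ≤ (k + l) % Q := Int.emod_nonneg _ (by omega)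
    have h2 : (k + l) % (Q : ℤ) < Q := Int.emod_lt_of_pos _ (by omega)
    exact (hmem _).mpr ⟨_, by omega, _, shiftBy_mem_shiftSpace _ hz, rfl⟩

omit [Fintype A] in
-- A periodic orbit is finite, hence closed, and by minimality it is the whole shift.
theorem Primitive.finite_of_periodic {σ : ℕ → Substitution A} {q : ℕ → ℕ} (hp : Primitive σ)
    (h : HasLengths σ q) (hq : ∀ n, 2 ≤ q n) {n : ℕ} {y : ℤ → A} (hy : y ∈ shiftSpace σ n)
    {k : ℤ} (hk : 0 < k) (hyk : shiftBy k y = y) : (shiftSpace σ n).Finite := by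
  have hfin : (Set.range fun i : ℤ => shiftBy i y).Finite := by
    refine ((Set.finite_Ico 0 k).image fun i : ℤ => shiftBy i y).subset ?_
    rintro _ ⟨i, rfl⟩
    refine ⟨i % k, ⟨Int.emod_nonneg _ hk.ne', Int.emod_lt_of_pos _ hk⟩, ?_⟩
    have : Function.Periodic (fun i : ℤ => shiftBy i y) k := fun i => by
      simp only
      rw [← shiftBy_shiftBy, hyk]
    have := this.sub_zsmul_eq (x := i) (i / k)
    rwa [smul_eq_mul, mul_comm, ← Int.emod_def] at this
  refine hfin.subset (hp.shiftSpace_subset h hq hfin.isClosed ?_ ⟨_, 0, rfl⟩ ?_)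
  · rintro _ ⟨i, rfl⟩
    exact shiftBy_mem_shiftSpace i hy
  · rintro j _ ⟨i, rfl⟩
    exact ⟨j + i, (shiftBy_shiftBy _ _ _).symm⟩

omit [Fintype A] in
-- The periodic two-sided extension of the right half of `y` has only words of `y`, so it lies in
-- the shift. This serves one-sided recognizability, where only the right half is seen.
theorem Primitive.finite_of_eventually_periodic {σ : ℕ → Substitution A} {q : ℕ → ℕ}
    (hp : Primitive σ) (h : HasLengths σ q) (hq : ∀ n, 2 ≤ q n) {n : ℕ} {y : ℤ → A}
    (hy : y ∈ shiftSpace σ n) {k : ℤ} (hk : 0 < k) (hyk : ∀ i, 0 ≤ i → y (i + k) = y i) :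
    (shiftSpace σ n).Finite := by
  have hmul : ∀ (a : ℕ) (b : ℤ), 0 ≤ b → y (b + k * a) = y b := by
    intro a b hb
    induction a with
    | zero => simp
    | succ a ih =>
      rw [← ih, ← hyk (b + k * a) (by positivity)]
      congr 1; push_cast; ring
  have hmod : ∀ i, 0 ≤ i → y (i % k) = y i := by
    intro i hi
    obtain ⟨a, ha⟩ := Int.eq_ofNat_of_zero_le (Int.ediv_nonneg hi hk.le)
    have := hmul a (i % k) (Int.emod_nonneg _ hk.ne')
    rw [← this, ← ha, Int.emod_add_mul_ediv]
  refine hp.finite_of_periodic h hq (y := fun i => y (i % k)) ?_ hk ?_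
  · intro i l
    have e : subword (fun i => y (i % k)) i l = subword y (i % k) l := by
      simp only [subword]
      refine List.map_congr_left fun j _ => ?_
      have h0 := Int.emod_nonneg i hk.ne'
      rw [← hmod (i % k + j) (by omega), Int.emod_add_emod]
    rw [e]
    exact hy _ _
  · funext i
    simp [shiftBy]

theorem Primitive.infinite_shiftSpace {σ : ℕ → Substitution A} {q : ℕ → ℕ} (hp : Primitive σ)
    (h : HasLengths σ q) (hq : ∀ n, 2 ≤ q n) (hne : ∀ n, (shiftSpace σ n).Nonempty)
    (hinf : (shiftSpace σ 0).Infinite) (n : ℕ) : (shiftSpace σ n).Infinite := by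
  intro hfin
  refine hinf ?_
  refine ((Finset.range (blockLength q 0 n)).finite_toSet.biUnion fun k _ =>
    hfin.image fun z => shiftBy (k : ℤ) ((block σ 0 n).onTwoSided z)).subset fun x hx => ?_
  obtain ⟨k, hk, z, hz, rfl⟩ := hp.exists_desubstitution h hq hne 0 n hx
  rw [zero_add] at hz
  simp only [Set.mem_iUnion]
  exact ⟨k, by simpa using hk, z, hz, rfl⟩

/-! ### Recognizability for a sequence with infinite shift -/

/-- A common form of two-sided and one-sided recognizability: `T^k σ_m(z)` determines `k` and `z`
if the sequences are compared on the index set `S`. -/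
def RecognizableOn (σ : ℕ → Substitution A) (q : ℕ → ℕ) (S : Set ℤ) : Prop :=
  ∀ m, ∀ z ∈ shiftSpace σ (m + 1), ∀ z' ∈ shiftSpace σ (m + 1), ∀ k < q m, ∀ k' < q m,
    Set.EqOn (shiftBy ((k : ℕ) : ℤ) ((σ m).onTwoSided z))
      (shiftBy ((k' : ℕ) : ℤ) ((σ m).onTwoSided z')) S →
    k = k' ∧ Set.EqOn z z' S

omit [Fintype A] [DecidableEq A] [TopologicalSpace A] [DiscreteTopology A] in
theorem HasLengths.onTwoSided_mem_succ {σ : ℕ → Substitution A} {q : ℕ → ℕ} (h : HasLengths σ q)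
    {m : ℕ} {x : ℤ → A} (hx : x ∈ shiftSpace σ (m + 1)) :
    (σ m).onTwoSided x ∈ shiftSpace σ m := by
  have := h.onTwoSided_mem (m := m) (n := 1) hx
  rwa [block_one] at this

omit [Fintype A] in
theorem Recognizable.recognizableOn {σ : ℕ → Substitution A} {q : ℕ → ℕ} (hr : Recognizable σ)
    (hp : Primitive σ) (h : HasLengths σ q) (hq : ∀ n, 2 ≤ q n)
    (hinf : ∀ n, (shiftSpace σ n).Infinite) : RecognizableOn σ q Set.univ := by
  intro m z hz z' hz' k hk k' hk' heq
  rw [Set.eqOn_univ] at heq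
  have hy := shiftBy_mem_shiftSpace k (h.onTwoSided_mem_succ hz)
  have hap : Aperiodic (shiftBy (k : ℤ) ((σ m).onTwoSided z)) := fun l hl hper => by
    rw [shift_iterate] at hper
    exact hinf m (hp.finite_of_periodic h hq hy (by omega) hper)
  have := @hr m _ hap (k, z) ⟨hz, by rw [shift_iterate], by rwa [h m]⟩
    (k', z') ⟨hz', by rw [shift_iterate]; exact heq, by rwa [h m]⟩
  rw [Prod.mk.injEq] at this
  exact ⟨this.1, fun i _ => by rw [this.2]⟩

omit [Fintype A] [DecidableEq A] [TopologicalSpace A] [DiscreteTopology A] in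
theorem subwordOne_natCast (x : ℤ → A) (i l : ℕ) :
    subwordOne (fun j : ℕ => x j) i l = subword x i l := by
  simp [subword, subwordOne]

omit [Fintype A] [DecidableEq A] [TopologicalSpace A] [DiscreteTopology A] in
theorem Substitution.onOneSided_natCast (s : Substitution A) (x : ℤ → A) :
    s.onOneSided (fun j : ℕ => x j) = fun j : ℕ => s.onTwoSided x j := by
  funext i
  change _ = s.onTwoSided x (Int.ofNat i)
  simp only [Substitution.onOneSided, Substitution.onTwoSided, subwordOne_natCast, Nat.cast_zero]

omit [Fintype A] [DecidableEq A] [TopologicalSpace A] [DiscreteTopology A] in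
theorem natCast_mem_shiftSpaceOne {σ : ℕ → Substitution A} {n : ℕ} {x : ℤ → A}
    (hx : x ∈ shiftSpace σ n) : (fun j : ℕ => x j) ∈ shiftSpaceOne σ n := fun i l => by
  rw [subwordOne_natCast]; exact subword_mem_language hx _ _

omit [Fintype A] in
-- Two-sided points are restricted to their nonnegative half; an infinite shift keeps these halves
-- aperiodic. The uniqueness part of the one-sided property then suffices.
theorem OneSidedRecognizable.recognizableOn {σ : ℕ → Substitution A} {q : ℕ → ℕ}
    (hr : OneSidedRecognizable σ) (hp : Primitive σ) (h : HasLengths σ q) (hq : ∀ n, 2 ≤ q n)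
    (hinf : ∀ n, (shiftSpace σ n).Infinite) : RecognizableOn σ q (Set.Ici 0) := by
  intro m z hz z' hz' k hk k' hk' heq
  have hy := shiftBy_mem_shiftSpace k (h.onTwoSided_mem_succ hz)
  have hap : AperiodicOne fun j : ℕ => shiftBy (k : ℤ) ((σ m).onTwoSided z) j := by
    intro l hl hper
    refine hinf m (hp.finite_of_eventually_periodic h hq hy (k := l) (by omega) fun i hi => ?_)
    obtain ⟨i, rfl⟩ := Int.eq_ofNat_of_zero_le hi
    have := congrFun hper i
    rw [shiftOne_iterate] at this
    simpa using this
  have hrep : ∀ (l : ℕ) (x : ℤ → A), (fun j : ℕ => shiftBy (l : ℤ) ((σ m).onTwoSided x) j) =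
      shiftOne^[l] ((σ m).onOneSided fun j : ℕ => x j) := by
    intro l x
    funext j
    rw [shiftOne_iterate, Substitution.onOneSided_natCast]
    simp [shiftBy]
  have heq' : (fun j : ℕ => shiftBy (k : ℤ) ((σ m).onTwoSided z) j) =
      fun j : ℕ => shiftBy (k' : ℤ) ((σ m).onTwoSided z') j :=
    funext fun j => heq (Set.mem_Ici.mpr (Int.natCast_nonneg j))
  have := (hr m _ (natCast_mem_shiftSpaceOne hy) hap).unique
    (y₁ := (k, fun j : ℕ => z j)) (y₂ := (k', fun j : ℕ => z' j))
    ⟨natCast_mem_shiftSpaceOne hz, hrep k z, by rwa [h m]⟩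
    ⟨natCast_mem_shiftSpaceOne hz', heq'.trans (hrep k' z'), by rwa [h m]⟩
  rw [Prod.mk.injEq] at this
  refine ⟨this.1, fun i hi => ?_⟩
  obtain ⟨i, rfl⟩ := Int.eq_ofNat_of_zero_le (Set.mem_Ici.mp hi)
  exact congrFun this.2 i

omit [Fintype A] [DecidableEq A] [TopologicalSpace A] [DiscreteTopology A] in
-- Mixed-radix digits: recognizability at level `m` fixes the lowest digit `k % q m`, and the
-- quotients `k / q m` are then compared at level `m + 1`.
theorem RecognizableOn.modEq {σ : ℕ → Substitution A} {q : ℕ → ℕ} {S : Set ℤ}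
    (hr : RecognizableOn σ q S) (h : HasLengths σ q) (n m : ℕ) {z z' : ℤ → A}
    (hz : z ∈ shiftSpace σ (m + n)) (hz' : z' ∈ shiftSpace σ (m + n)) {k k' : ℤ}
    (heq : Set.EqOn (shiftBy k ((block σ m n).onTwoSided z))
      (shiftBy k' ((block σ m n).onTwoSided z')) S) :
    k ≡ k' [ZMOD blockLength q m n] := by
  induction n generalizing m k k' with
  | zero => simpa [blockLength] using Int.modEq_one
  | succ n ih =>
    have hc : (σ m).ConstLength (q m) := h m
    have hQ := hc.pos (z 0)
    have e : block σ m (n + 1) = (σ m).comp (block σ (m + 1) n) := by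
      rw [add_comm n 1, block_add, block_one]
    rw [show m + (n + 1) = m + 1 + n by ring] at hz hz'
    rw [e, hc.onTwoSided_comp (h.block _ _), hc.onTwoSided_comp (h.block _ _),
      hc.shiftBy_onTwoSided k, hc.shiftBy_onTwoSided k'] at heq
    have h1 : (0 : ℤ) ≤ k % q m := Int.emod_nonneg _ (by omega)
    have h2 : k % (q m : ℤ) < q m := Int.emod_lt_of_pos _ (by omega)
    have h1' : (0 : ℤ) ≤ k' % q m := Int.emod_nonneg _ (by omega)
    have h2' : k' % (q m : ℤ) < q m := Int.emod_lt_of_pos _ (by omega)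
    obtain ⟨hk, hx⟩ := hr m _ (shiftBy_mem_shiftSpace _ (h.onTwoSided_mem hz)) _
      (shiftBy_mem_shiftSpace _ (h.onTwoSided_mem hz')) _ (by omega) _ (by omega) heq
    have hk' : k % (q m : ℤ) = k' % q m := by omega
    obtain ⟨c, hcc⟩ := (ih (m + 1) hz hz' hx).dvd
    refine Int.modEq_iff_dvd.mpr ⟨c, ?_⟩
    rw [blockLength_succ']
    have a1 := Int.emod_add_mul_ediv k (q m)
    have a2 := Int.emod_add_mul_ediv k' (q m)
    push_cast
    linear_combination (q m : ℤ) * hcc - a2 + a1 - hk'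

end Topology

/-! ### Cyclic factors -/

/-- `(X, T)` has the rotation by `1` on `ℤ/m` as a factor. -/
def HasCyclicFactor {X : Type u} [TopologicalSpace X] (T : X → X) (m : ℕ) : Prop :=
  ∃ f : X → ZMod m, IsLocallyConstant f ∧ ∀ x, f (T x) = f x + 1

theorem HasCyclicFactor.of_dvd {X : Type u} [TopologicalSpace X] {T : X → X} {m d : ℕ}
    (h : HasCyclicFactor T m) (hd : d ∣ m) : HasCyclicFactor T d := by
  obtain ⟨f, hf, hfT⟩ := h
  refine ⟨fun x => ZMod.castHom hd (ZMod d) (f x), hf.comp (ZMod.castHom hd (ZMod d)), fun x => ?_⟩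
  simp only [hfT, map_add, map_one]

theorem apply_iterate_of_apply_succ {X : Type u} {T : X → X} {m : ℕ} {f : X → ZMod m}
    (hf : ∀ x, f (T x) = f x + 1) (j : ℕ) (x : X) : f (T^[j] x) = f x + j := by
  induction j with
  | zero => simp
  | succ j ih => rw [Function.iterate_succ_apply', hf, ih]; push_cast; ring

theorem surjective_of_apply_succ {X : Type u} [Nonempty X] {T : X → X} {m : ℕ} [NeZero m]
    {f : X → ZMod m} (hf : ∀ x, f (T x) = f x + 1) : Function.Surjective f := by
  intro c
  obtain ⟨x⟩ := ‹Nonempty X›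
  refine ⟨T^[(c - f x).val] x, ?_⟩
  rw [apply_iterate_of_apply_succ hf, ZMod.natCast_zmod_val]
  ring

theorem HasCyclicFactor.le_card {X : Type u} [TopologicalSpace X] [Finite X] [Nonempty X]
    {T : X → X} {m : ℕ} [NeZero m] (h : HasCyclicFactor T m) : m ≤ Nat.card X := by
  obtain ⟨f, -, hf⟩ := h
  simpa using Nat.card_le_card_of_surjective f (surjective_of_apply_succ hf)

theorem SameMaximalEquicontinuousFactor.symm {X Y : Type u} [TopologicalSpace X]
    [TopologicalSpace Y] {T : X → X} {R : Y → Y} (h : SameMaximalEquicontinuousFactor T R) :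
    SameMaximalEquicontinuousFactor R T := by
  obtain ⟨Z, i, S, π, ρ, h1, h2⟩ := h
  exact ⟨Z, i, S, ρ, π, h2, h1⟩

/-- A cyclic factor of `(X, T)` is a factor of the maximal equicontinuous factor. -/
theorem HasCyclicFactor.of_sameMaximalEquicontinuousFactor {X Y : Type u} [TopologicalSpace X]
    [TopologicalSpace Y] [Nonempty X] {T : X → X} {R : Y → Y} {m : ℕ} [NeZero m]
    (h : HasCyclicFactor T m) (hTR : SameMaximalEquicontinuousFactor T R) :
    HasCyclicFactor R m := by
  obtain ⟨Z, i, S, π, ρ, hπ, hρ⟩ := hTR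
  obtain ⟨f, hf, hfT⟩ := h
  -- `ULift` puts the rotation in the universe over which `maximal` quantifies. The discrete
  -- uniformity, transported onto the existing topology, makes equicontinuity trivial: points are
  -- open.
  let _ : UniformSpace (ULift.{u} (ZMod m)) :=
    (⊥ : UniformSpace (ULift.{u} (ZMod m))).replaceTopology DiscreteTopology.eq_bot
  let S' : ULift.{u} (ZMod m) ≃ₜ ULift.{u} (ZMod m) :=
    { toFun := fun z => ⟨z.down + 1⟩
      invFun := fun z => ⟨z.down - 1⟩
      left_inv := fun z => by simp
      right_inv := fun z => by simp
      continuous_toFun := continuous_of_discreteTopology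
      continuous_invFun := continuous_of_discreteTopology }
  obtain ⟨φ, hφ, hφS, hφπ⟩ := hπ.maximal (ULift.{u} (ZMod m)) S' (fun x => ⟨f x⟩)
    { compactSpace := Finite.compactSpace
      t2Space := inferInstance
      equicontinuous := fun z U hU => by
        rw [nhds_discrete, Filter.eventually_pure]
        exact fun n => refl_mem_uniformity hU
      continuous := (hf.comp ULift.up).continuous
      surjective := fun c => by
        obtain ⟨x, hx⟩ := surjective_of_apply_succ hfT c.down
        exact ⟨x, ULift.ext _ _ hx⟩
      semiconj := fun x => by
        change ULift.up _ = ULift.up _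
        rw [hfT] }
  have hc : IsLocallyConstant fun y => φ (ρ y) :=
    (IsLocallyConstant.iff_continuous _).mpr (hφ.comp hρ.isFactor.continuous)
  refine ⟨fun y => (φ (ρ y)).down, hc.comp ULift.down, fun y => ?_⟩
  simp only
  rw [hρ.isFactor.semiconj y, hφS (ρ y)]
  rfl

/-! ### Cyclic factors of constant-length `S`-adic shifts: existence and obstruction -/

section Cyclic

variable {A : Type u} [Fintype A] [DecidableEq A] [TopologicalSpace A] [DiscreteTopology A]

omit [Fintype A] [DecidableEq A] [TopologicalSpace A] [DiscreteTopology A] in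
theorem adicShift_iterate (σ : ℕ → Substitution A) (j : ℕ) (x : shiftSpace σ 0) :
    ((adicShift σ)^[j] x).1 = shiftBy j x.1 := by
  rw [← shift_iterate]
  induction j with
  | zero => rfl
  | succ j ih => rw [Function.iterate_succ_apply', Function.iterate_succ_apply', ← ih]; rfl

/-- By recognizability, `(X_σ, T)` has the rotation on `ℤ/(q_0 ⋯ q_{n-1})` as a factor. -/
theorem RecognizableOn.hasCyclicFactor {σ : ℕ → Substitution A} {q : ℕ → ℕ} {S : Set ℤ}
    (hr : RecognizableOn σ q S) (hp : Primitive σ) (h : HasLengths σ q) (hq : ∀ n, 2 ≤ q n)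
    (hne : ∀ n, (shiftSpace σ n).Nonempty) (n : ℕ) :
    HasCyclicFactor (adicShift σ) (blockLength q 0 n) := by
  have : NeZero (blockLength q 0 n) := ⟨(blockLength_pos hq 0 n).ne'⟩
  have hex : ∀ y : shiftSpace σ 0, ∃ k : ℤ, ∃ z ∈ shiftSpace σ (0 + n),
      y.1 = shiftBy k ((block σ 0 n).onTwoSided z) := fun y => by
    obtain ⟨k, -, z, hz, e⟩ := hp.exists_desubstitution h hq hne 0 n y.2
    exact ⟨k, z, hz, e⟩
  choose κ ζ hζ hκ using hex
  have key : ∀ (y : shiftSpace σ 0) (k : ℤ), ∀ z ∈ shiftSpace σ (0 + n),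
      y.1 = shiftBy k ((block σ 0 n).onTwoSided z) →
        ((κ y : ℤ) : ZMod (blockLength q 0 n)) = k := fun y k z hz e =>
    (ZMod.intCast_eq_intCast_iff _ _ _).mpr
      (hr.modEq h n 0 (hζ y) hz fun i _ => by rw [← hκ y, e])
  refine ⟨fun y => (κ y : ZMod (blockLength q 0 n)), ?_, fun y => ?_⟩
  -- Each fibre is the trace of a compact image, hence closed; as there are finitely many, every
  -- preimage is also open.
  · have hcl : ∀ c : ZMod (blockLength q 0 n),
        IsClosed ((fun y => (κ y : ZMod (blockLength q 0 n))) ⁻¹' {c}) := by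
      intro c
      have e : (fun y => (κ y : ZMod (blockLength q 0 n))) ⁻¹' {c} = Subtype.val ⁻¹'
          ((fun z => shiftBy (c.val : ℤ) ((block σ 0 n).onTwoSided z)) ''
            shiftSpace σ (0 + n)) := by
        ext y
        simp only [Set.mem_preimage, Set.mem_singleton_iff, Set.mem_image]
        constructor
        · intro hy
          have hmod : κ y ≡ (c.val : ℤ) [ZMOD blockLength q 0 n] := by
            rw [← ZMod.intCast_eq_intCast_iff, hy]; simp
          obtain ⟨d, hd⟩ := hmod.symm.dvd
          refine ⟨shiftBy d (ζ y), shiftBy_mem_shiftSpace _ (hζ y), ?_⟩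
          rw [hκ y, (h.block 0 n).onTwoSided_shiftBy, shiftBy_shiftBy]
          congr 1
          linarith
        · rintro ⟨z, hz, e⟩
          rw [key y _ z hz e.symm]; simp
      rw [e]
      exact ((isCompact_shiftSpace σ (0 + n)).image ((continuous_shiftBy _).comp
        (h.block 0 n).continuous_onTwoSided)).isClosed.preimage continuous_subtype_val
    intro s
    rw [← compl_compl s, Set.preimage_compl, isOpen_compl_iff, ← Set.biUnion_of_singleton sᶜ,
      Set.preimage_iUnion₂]
    exact Set.Finite.isClosed_biUnion (Set.toFinite _) fun c _ => hcl c
  · have := key (adicShift σ y) (1 + κ y) (ζ y) (hζ y) (by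
      rw [← shiftBy_shiftBy, ← hκ y]; exact (shift_iterate 1 y.1).trans rfl)
    simp only
    rw [this]; push_cast; ring

omit [DecidableEq A] in
/-- A locally constant function on `X_σ` depends on a window of fixed size only. -/
theorem exists_uniform_window {σ : ℕ → Substitution A} {B : Type v} {f : shiftSpace σ 0 → B}
    (hf : IsLocallyConstant f) :
    ∃ L : ℕ, ∀ x y : shiftSpace σ 0, (∀ i : ℤ, -L ≤ i → i < L → x.1 i = y.1 i) → f x = f y := by
  have : CompactSpace (shiftSpace σ 0) := isCompact_iff_compactSpace.mp (isCompact_shiftSpace σ 0)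
  have hloc : ∀ x : shiftSpace σ 0, ∃ L : ℕ, ∀ y : shiftSpace σ 0,
      (∀ i : ℤ, -L ≤ i → i < L → y.1 i = x.1 i) → f y = f x := by
    intro x
    obtain ⟨U, hU, hUf⟩ := isOpen_induced_iff.mp (hf.isOpen_fiber (f x))
    have hx : x.1 ∈ U := by
      have : x ∈ Subtype.val ⁻¹' U := by rw [hUf]; rfl
      exact this
    obtain ⟨L, hL⟩ := exists_window hU hx
    refine ⟨L, fun y hy => ?_⟩
    have : y ∈ Subtype.val ⁻¹' U := hL y.1 hy
    rw [hUf] at this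
    exact this
  choose L hL using hloc
  have hnhds : ∀ x : shiftSpace σ 0,
      {y : shiftSpace σ 0 | ∀ i : ℤ, -L x ≤ i → i < L x → y.1 i = x.1 i} ∈ nhds x := by
    intro x
    have e : {y : shiftSpace σ 0 | ∀ i : ℤ, -L x ≤ i → i < L x → y.1 i = x.1 i} =
        ⋂ i ∈ Set.Ico (-(L x : ℤ)) (L x), {y : shiftSpace σ 0 | y.1 i = x.1 i} := by
      ext y; simp
    rw [e]
    refine IsOpen.mem_nhds (Set.Finite.isOpen_biInter (Set.finite_Ico _ _) fun i _ => ?_) (by simp)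
    have hcont : Continuous fun y : shiftSpace σ 0 => y.1 i :=
      (continuous_apply i).comp continuous_subtype_val
    exact (isOpen_discrete {x.1 i}).preimage hcont
  obtain ⟨t, ht⟩ := finite_cover_nhds hnhds
  refine ⟨t.sup L, fun x y hxy => ?_⟩
  obtain ⟨c, hc, hxc⟩ := Set.mem_iUnion₂.mp (ht ▸ Set.mem_univ x)
  have hle : L c ≤ t.sup L := Finset.le_sup hc
  rw [hL c x hxc, hL c y fun i hi hi' => ?_]
  rw [← hxy i (by omega) (by omega)]
  exact hxc i hi hi'

omit [DecidableEq A] in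
/-- The order of a cyclic factor of `(X_σ, T)` is at most `|A|²` if it is coprime to all lengths. -/
theorem HasCyclicFactor.le_card_sq {σ : ℕ → Substitution A} {q : ℕ → ℕ} (h : HasLengths σ q)
    (hq : ∀ n, 2 ≤ q n) (hne : ∀ n, (shiftSpace σ n).Nonempty) {m : ℕ} [NeZero m]
    (hm : HasCyclicFactor (adicShift σ) m) (hcop : ∀ n, m.Coprime (q n)) :
    m ≤ Fintype.card A * Fintype.card A := by
  obtain ⟨f, hf, hfT⟩ := hm
  obtain ⟨L, hL⟩ := exists_uniform_window hf
  -- `L` factors suffice for `R ≥ 2^L > L`, so the window of radius `L` around a seam meets only the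
  -- two adjacent blocks.
  set R := blockLength q 0 L with hR
  have hLR : L < R := Nat.lt_two_pow_self.trans_le (two_pow_le_blockLength hq 0 L)
  have hc : (block σ 0 L).ConstLength R := h.block 0 L
  have hcopR : R.Coprime m := Nat.Coprime.prod_left fun i _ => (hcop _).symm
  obtain ⟨z, hz⟩ := hne (0 + L)
  let y : shiftSpace σ 0 := ⟨_, h.onTwoSided_mem hz⟩
  have hy : ∀ j : ℕ, ((adicShift σ)^[R * j] y).1 = (block σ 0 L).onTwoSided (shiftBy j z) := by
    intro j
    rw [adicShift_iterate, hc.onTwoSided_shiftBy]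
    push_cast; rfl
  -- Around position `R * j` the window shows only the images of `z_{j-1}` and `z_j`, so this pair
  -- determines `f(T^{Rj} y) = f(y) + Rj`. As `R` is a unit modulo `m`, it determines `j`.
  have hinj : Function.Injective fun j : Fin m => (z ((j : ℕ) - 1), z (j : ℕ)) := by
    intro j j' hjj
    simp only [Prod.mk.injEq] at hjj
    have hff : f ((adicShift σ)^[R * (j : ℕ)] y) = f ((adicShift σ)^[R * (j' : ℕ)] y) := by
      refine hL _ _ fun i hi hi' => ?_
      rw [hy, hy]
      refine hc.onTwoSided_congr ?_
      simp only [shiftBy]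
      rcases lt_or_ge i 0 with h0 | h0
      · have : i / (R : ℤ) = -1 := by
          rw [Int.ediv_eq_iff_of_pos (by omega)]
          constructor <;> linarith
        rw [this, neg_add_eq_sub, neg_add_eq_sub]
        exact hjj.1
      · rw [Int.ediv_eq_zero_of_lt h0 (by omega), zero_add, zero_add]
        exact hjj.2
    rw [apply_iterate_of_apply_succ hfT, apply_iterate_of_apply_succ hfT, add_right_inj] at hff
    push_cast at hff
    have hu : IsUnit (R : ZMod m) := (ZMod.isUnit_iff_coprime R m).mpr hcopR
    have := (ZMod.natCast_eq_natCast_iff' _ _ _).mp (hu.mul_left_cancel hff)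
    rw [Nat.mod_eq_of_lt j.2, Nat.mod_eq_of_lt j'.2] at this
    exact Fin.ext this
  simpa using Fintype.card_le_of_injective _ hinj

theorem Primitive.hasCyclicFactor_of_infinite {σ : ℕ → Substitution A} {q : ℕ → ℕ}
    (hp : Primitive σ) (h : HasLengths σ q) (hq : ∀ n, 2 ≤ q n)
    (hne : ∀ n, (shiftSpace σ n).Nonempty) (hr : OneSidedRecognizable σ ∨ Recognizable σ)
    (hinf : (shiftSpace σ 0).Infinite) (n : ℕ) :
    HasCyclicFactor (adicShift σ) (blockLength q 0 n) := by
  have hinf' := hp.infinite_shiftSpace h hq hne hinf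
  rcases hr with hr | hr
  · exact (hr.recognizableOn hp h hq hinf').hasCyclicFactor hp h hq hne n
  · exact (hr.recognizableOn hp h hq hinf').hasCyclicFactor hp h hq hne n

omit [Fintype A] [DecidableEq A] [TopologicalSpace A] [DiscreteTopology A] in
theorem FullyEssential.nonempty {σ : ℕ → Substitution A} {w : List A} (h : FullyEssential σ w)
    (n : ℕ) : (shiftSpace σ n).Nonempty := by
  obtain ⟨x, hx, -⟩ := h n
  exact ⟨x, hx⟩

theorem exists_pow_dvd_blockLength {q : ℕ → ℕ} {p : ℕ} (hinf : {m | p ∣ q m}.Infinite) (k : ℕ) :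
    ∃ n, p ^ k ∣ blockLength q 0 n := by
  induction k with
  | zero => exact ⟨0, by simp⟩
  | succ k ih =>
    obtain ⟨n, hn⟩ := ih
    obtain ⟨m, hm, hnm⟩ := hinf.exists_gt n
    refine ⟨m + 1, ?_⟩
    -- The index `m` lies beyond `n`, so `q m` contributes a factor `p` not counted in the first `n`
    -- lengths.
    rw [blockLength_succ, pow_succ, zero_add]
    refine mul_dvd_mul (hn.trans ?_) hm
    exact Finset.prod_dvd_prod_of_subset _ _ _ (Finset.range_mono hnm.le)

end Cyclic

end SAdic

/-! ### Conclusion: two cardinality contradictions -/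

theorem mainTheorem7 {A : Type u} [Fintype A] [DecidableEq A] [TopologicalSpace A]
    [DiscreteTopology A] (σ τ : ℕ → SAdic.Substitution A) (q r : ℕ → ℕ)
    (hσ_fin : SAdic.Finitary σ) (hτ_fin : SAdic.Finitary τ)
    (hσ_prim : SAdic.Primitive σ) (hτ_prim : SAdic.Primitive τ)
    (hσ_len : SAdic.HasLengths σ q) (hτ_len : SAdic.HasLengths τ r)
    (hq : ∀ n, 2 ≤ q n) (hr : ∀ n, 2 ≤ r n)
    (hq_inf : ∀ n, {m | q m = q n}.Infinite) (hr_inf : ∀ n, {m | r m = r n}.Infinite)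
    (hσ_ess : ∃ a b, SAdic.FullyEssential σ [a, b])
    (hτ_ess : ∃ a b, SAdic.FullyEssential τ [a, b])
    (hrec :
      ((SAdic.PrefixStraight σ ∧ SAdic.OneSidedRecognizable σ) ∧
        (SAdic.PrefixStraight τ ∧ SAdic.OneSidedRecognizable τ)) ∨
      ((SAdic.Straight σ ∧ SAdic.Recognizable σ) ∧
        (SAdic.Straight τ ∧ SAdic.Recognizable τ)))
    (hprime : ∃ p : ℕ, p.Prime ∧ (∃ n, p ∣ q n) ∧ ∀ n, ¬ p ∣ r n)
    (hmef : SAdic.SameMaximalEquicontinuousFactor (SAdic.adicShift σ) (SAdic.adicShift τ)) :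
    (SAdic.shiftSpace σ 0).Finite ∧ (SAdic.shiftSpace τ 0).Finite := by
  obtain ⟨a, b, hab⟩ := hσ_ess
  obtain ⟨a', b', hab'⟩ := hτ_ess
  have hσ_ne := hab.nonempty
  have hτ_ne := hab'.nonempty
  have := (hσ_ne 0).to_subtype
  have := (hτ_ne 0).to_subtype
  have hσ_rec : SAdic.OneSidedRecognizable σ ∨ SAdic.Recognizable σ := by tauto
  have hτ_rec : SAdic.OneSidedRecognizable τ ∨ SAdic.Recognizable τ := by tauto
  obtain ⟨p, hp, ⟨n₀, hn₀⟩, hpr⟩ := hprime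
  have hσ_finite : (SAdic.shiftSpace σ 0).Finite := by
    by_contra hinf
    -- The exponent is the bound `|A|²` itself, since `p ^ K > K`.
    set K := Fintype.card A * Fintype.card A
    obtain ⟨n, hn⟩ := SAdic.exists_pow_dvd_blockLength
      ((hq_inf n₀).mono fun m (hm : q m = q n₀) => show p ∣ q m from hm ▸ hn₀) K
    have : NeZero (p ^ K) := ⟨pow_ne_zero _ hp.ne_zero⟩
    have hfac := ((hσ_prim.hasCyclicFactor_of_infinite hσ_len hq hσ_ne hσ_rec hinf n).of_dvd
      hn).of_sameMaximalEquicontinuousFactor hmef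
    have hle := hfac.le_card_sq hτ_len hr hτ_ne fun n =>
      ((Nat.Prime.coprime_iff_not_dvd hp).mpr (hpr n)).pow_left K
    exact absurd hle (not_le.mpr (Nat.lt_pow_self hp.one_lt))
  refine ⟨hσ_finite, ?_⟩
  by_contra hinf
  have := hσ_finite.to_subtype
  -- A product of `K` lengths is at least `2 ^ K > K`, so this rotation has more points than `X_σ`,
  -- which would map onto it.
  set K := Nat.card (SAdic.shiftSpace σ 0)
  have : NeZero (SAdic.blockLength r 0 K) := ⟨(SAdic.blockLength_pos hr 0 K).ne'⟩
  have hle := ((hτ_prim.hasCyclicFactor_of_infinite hτ_len hr hτ_ne hτ_rec hinf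
    K).of_sameMaximalEquicontinuousFactor hmef.symm).le_card
  have := SAdic.two_pow_le_blockLength hr 0 K
  have := Nat.lt_two_pow_self (n := K)
  omega
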